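/- Let $d\ge 1$, let $\mathbf r=(r_1,\dots,r_d)\in\mathbb N^d$ with $\mathbf r\neq 0$, write $\|\mathbf r\|_1=r_1+\dots+r_d$, and let $\mu$ be Lebesgue measure on $\mathbb R^d$. For $\mathbf j\in\mathbb Z^d$ let $$\mathcal I(\mathbf j)=\Big\{\prod_{i=1}^d[k_i2^{-j_i},(k_i+1)2^{-j_i}):\mathbf k\in\mathbb Z^d\Big\},$$ and let $m_{dir}(\mathbf r,\mathcal I(\mathbf j))$ be the set of functions $f=\sum_{I\in\mathcal I(\mathbf j)}f_I\mathbf 1_I$ where each $f_I$ is a polynomial with rational coefficients of degree at most $r_i$ in the $i$-th variable for every $i$, and only finitely many $f_I$ are nonzero. Let $\mathcal M_{\mathbf r}=\{m_{dir}(\mathbf r,\mathcal I(\mathbf j)):\mathbf j\in\mathbb Z^d\}$ and, for $m=m_{dir}(\mathbf r,\mathcal I(\mathbf j))\in\mathcal M_{\mathbf r}$, let $$h_m=\frac{\min_{I\in\mathcal I(\mathbf j)}\mu(I)}{(2\|\mathbf r\|_1^2)^d\,4^{d+1}}=\frac{2^{-(j_1+\dots+j_d)}}{(2\|\mathbf r\|_1^2)^d\,4^{d+1}}.$$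 Let $\mathcal C_{rec}$ be the class of open rectangles $\prod_{i=1}^d(a_i,b_i)$ with $a_i<b_i$ real. For $h>0$ and $f\in L^1\cap L^\infty$ let $|f|_h=\sup_{C\in\mathcal C_{rec}}\frac{1}{\mu(C)+h}\left|\int_C f\,d\mu\right|$, and for a set of functions $m\subset L^1\cap L^\infty$ let $$\kappa_m(h)=\inf\Big\{\frac{|p-q|_h}{\|p-q\|_\infty}:\ p,q\in m,\ \|p-q\|_\infty\neq 0\Big\},$$ where $\|\cdot\|_\infty$ is the essential supremum norm. Theorem. For all $m,m'\in\mathcal M_{\mathbf r}$, $$\kappa_{m\cup m'}(h_m\wedge h_{m'})\ \ge\ \left[4\left(1+4\sqrt{\prod_{i=1}^d(r_i+1)}\right)\right]^{-1}.$$ Moreover, $h_m>0$ for every $m\in\mathcal M_{\mathbf r}$, and consequently $$\kappa_*=\inf_{m,m'\in\mathcal M_{\mathbf r}}\kappa_{m\cup m'}(h_m\wedge h_{m'})>0.$$ -/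

import Mathlib

open MeasureTheory
open scoped ENNReal

namespace SupNorm

/-! ### The norms `|f|_h` and the constants `κ_m(h)` -/

section General

variable {E : Type*} [MeasurableSpace E]

/-- `|f|_h = sup_{C ∈ 𝒞} |∫_C f dμ| / (μ(C) + h)`, as an extended nonnegative number. -/
noncomputable def hNorm (μ : Measure E) (𝒞 : Set (Set E)) (h : ℝ) (f : E → ℝ) : ℝ≥0∞ :=
  ⨆ C ∈ 𝒞, ENNReal.ofReal |∫ x in C, f x ∂μ| / (μ C + ENNReal.ofReal h)

/-- `κ_m(h) = inf_{p, q ∈ m} |p - q|_h / ‖p - q‖_∞`, where `‖·‖_∞` is the essential supremum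
and the infimum is over the pairs for which the quotient makes sense, i.e. `p ≠ q` a.e. -/
noncomputable def kappa (μ : Measure E) (𝒞 : Set (Set E)) (m : Set (E → ℝ)) (h : ℝ) : ℝ≥0∞ :=
  ⨅ p ∈ m, ⨅ q ∈ m, ⨅ _ : eLpNorm (p - q) ⊤ μ ≠ 0,
    hNorm μ 𝒞 h (p - q) / eLpNorm (p - q) ⊤ μ

/-- `κ_* = inf_{m, m' ∈ M} κ_{m ∪ m'}(h_m ∧ h_{m'})`. -/
noncomputable def kappaStar (μ : Measure E) (𝒞 : Set (Set E)) (M : Set (Set (E → ℝ)))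
    (h : Set (E → ℝ) → ℝ) : ℝ≥0∞ :=
  ⨅ m ∈ M, ⨅ m' ∈ M, kappa μ 𝒞 (m ∪ m') (min (h m) (h m'))

/-- The assumption on a collection of models `M` with parameters `(h_m)_{m ∈ M}` under which
model selection is performed: the `h_m` are positive and `κ_* > 0`. -/
def ModelSelectionAssumption (μ : Measure E) (𝒞 : Set (Set E)) (M : Set (Set (E → ℝ)))
    (h : Set (E → ℝ) → ℝ) : Prop :=
  (∀ m ∈ M, 0 < h m) ∧ 0 < kappaStar μ 𝒞 M h

end General

/-! ### Piecewise polynomials on regular dyadic partitions -/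

variable {d : ℕ}

/-- The open rectangles of `ℝ^d` with sides parallel to the axes. -/
def openRectangles (d : ℕ) : Set (Set (Fin d → ℝ)) :=
  {C | ∃ a b : Fin d → ℝ, (∀ i, a i < b i) ∧ C = Set.univ.pi fun i => Set.Ioo (a i) (b i)}

/-- The dyadic cell `∏_i [k_i 2^{-j_i}, (k_i + 1) 2^{-j_i})`. -/
def dyadicCell (j k : Fin d → ℤ) : Set (Fin d → ℝ) :=
  Set.univ.pi fun i => Set.Ico ((k i : ℝ) * 2 ^ (-j i)) (((k i : ℝ) + 1) * 2 ^ (-j i))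

/-- The regular dyadic partition `𝓘(j)`. -/
def dyadicPartition (j : Fin d → ℤ) : Set (Set (Fin d → ℝ)) :=
  Set.range (dyadicCell j)

/-- `m_dir(r, 𝓘)`: the functions `f = ∑_{I ∈ 𝓘} f_I 1_I`, where the `f_I` are polynomials with
rational coefficients, of degree at most `r_i` in the `i`-th variable, only finitely many of them
nonzero. Since `𝓘` is a partition, the identity says that `f` agrees with `f_I` on each `I ∈ 𝓘`. -/
def piecewisePoly (r : Fin d → ℕ) (𝓘 : Set (Set (Fin d → ℝ))) : Set ((Fin d → ℝ) → ℝ) :=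
  {f | ∃ P : Set (Fin d → ℝ) → MvPolynomial (Fin d) ℚ,
    (∀ I ∈ 𝓘, ∀ i, (P I).degreeOf i ≤ r i) ∧
    {I ∈ 𝓘 | P I ≠ 0}.Finite ∧
    ∀ I ∈ 𝓘, ∀ x ∈ I, f x = MvPolynomial.aeval x (P I)}

/-- The collection `𝓜_r` of the models `m_dir(r, 𝓘(j))`, `j ∈ ℤ^d`. -/
def dyadicModels (r : Fin d → ℕ) : Set (Set ((Fin d → ℝ) → ℝ)) :=
  Set.range fun j : Fin d → ℤ => piecewisePoly r (dyadicPartition j)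

open Classical in
/-- The parameter `h_m = 2^{-(j_1 + … + j_d)} / ((2 ‖r‖_1^2)^d 4^{d+1})` of the model
`m = m_dir(r, 𝓘(j))`. It does not depend on the choice of `j`, see `bandwidth_piecewisePoly`.
The numerator is the common volume of the cells of `𝓘(j)`, see `volume_dyadicCell`. -/
noncomputable def bandwidth (r : Fin d → ℕ) (m : Set ((Fin d → ℝ) → ℝ)) : ℝ :=
  if hm : ∃ j : Fin d → ℤ, piecewisePoly r (dyadicPartition j) = m then
    (2 : ℝ) ^ (-∑ i, hm.choose i) / ((2 * ((∑ i, r i : ℕ) : ℝ) ^ 2) ^ d * 4 ^ (d + 1))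
  else 0

theorem volume_dyadicCell (j k : Fin d → ℤ) :
    volume (dyadicCell j k) = ENNReal.ofReal ((2 : ℝ) ^ (-∑ i, j i)) := by
  have h2 : (2 : ℝ) ^ (-∑ i, j i) = ∏ i, (2 : ℝ) ^ (-j i) := by
    rw [← Finset.sum_neg_distrib]
    induction (Finset.univ : Finset (Fin d)) using Finset.cons_induction with
    | empty => simp
    | cons a s ha ih => rw [Finset.sum_cons, Finset.prod_cons, zpow_add₀ two_ne_zero, ih]
  rw [dyadicCell, Real.volume_pi_Ico, h2, ENNReal.ofReal_prod_of_nonneg (fun i _ => by positivity)]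
  refine Finset.prod_congr rfl fun i _ => ?_
  congr 1
  ring

theorem dyadicCell_subset_of_eq {r : Fin d → ℕ} {j j' : Fin d → ℤ}
    (h : piecewisePoly r (dyadicPartition j) = piecewisePoly r (dyadicPartition j')) :
    dyadicCell j' 0 ⊆ dyadicCell j 0 := by
  classical
  have z : ∀ l : Fin d → ℤ, (0 : Fin d → ℝ) ∈ dyadicCell l 0 := fun l => by
    simp only [dyadicCell, Set.mem_univ_pi]
    intro i
    simp only [Pi.zero_apply, Int.cast_zero, zero_mul, zero_add, one_mul, Set.mem_Ico, le_refl,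
      true_and]
    positivity
  have disj : ∀ k : Fin d → ℤ, ∀ x ∈ dyadicCell j k, x ∈ dyadicCell j 0 → k = 0 := by
    intro k x hx hx0
    simp only [dyadicCell, Set.mem_univ_pi, Set.mem_Ico] at hx hx0
    funext i
    have hp : (0 : ℝ) < 2 ^ (-j i) := by positivity
    have h1 := lt_of_mul_lt_mul_right ((hx i).1.trans_lt (hx0 i).2) hp.le
    have h2 := lt_of_mul_lt_mul_right ((hx0 i).1.trans_lt (hx i).2) hp.le
    simp only [Pi.zero_apply, Int.cast_zero, zero_add] at h1 h2
    have h3 : k i < 1 := by exact_mod_cast h1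
    have h4 : (0 : ℤ) < k i + 1 := by exact_mod_cast h2
    simp only [Pi.zero_apply]
    omega
  have hmem : (dyadicCell j 0).indicator (fun _ => (1 : ℝ)) ∈
      piecewisePoly r (dyadicPartition j) := by
    refine ⟨fun I => if I = dyadicCell j 0 then 1 else 0, ?_, ?_, ?_⟩
    · intro I _ i
      dsimp only
      split_ifs
      · rw [MvPolynomial.degreeOf_one]; exact Nat.zero_le _
      · rw [MvPolynomial.degreeOf_zero]; exact Nat.zero_le _
    · refine (Set.finite_singleton (dyadicCell j 0)).subset fun I hI => ?_
      by_contra hne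
      exact hI.2 (if_neg hne)
    · rintro _ ⟨k, rfl⟩ x hx
      by_cases h0 : x ∈ dyadicCell j 0
      · obtain rfl := disj k x hx h0
        simp [h0]
      · have : dyadicCell j k ≠ dyadicCell j 0 := fun e => h0 (e ▸ hx)
        simp [h0, this]
  rw [h] at hmem
  obtain ⟨P, -, -, hP⟩ := hmem
  have hP' := hP (dyadicCell j' 0) ⟨0, rfl⟩
  have hcont : Continuous fun x : Fin d → ℝ => MvPolynomial.aeval x (P (dyadicCell j' 0)) := by
    have := MvPolynomial.continuous_eval
      (MvPolynomial.map (algebraMap ℚ ℝ) (P (dyadicCell j' 0)))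
    simpa only [MvPolynomial.eval_map, MvPolynomial.aeval_def] using this
  have hconn : IsPreconnected (dyadicCell j' 0) :=
    (convex_pi fun i _ => convex_Ico _ _).isPreconnected
  intro x hx
  by_contra hx0
  have e0 := hP' 0 (z j')
  have e1 := hP' x hx
  rw [Set.indicator_of_mem (z j)] at e0
  rw [Set.indicator_of_notMem hx0] at e1
  obtain ⟨y, hy, hy'⟩ := hconn.intermediate_value hx (z j') hcont.continuousOn
    (show (1 / 2 : ℝ) ∈ _ by simp only [← e0, ← e1, Set.mem_Icc]; norm_num)
  have e2 := hP' y hy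
  simp only at hy'
  rw [hy'] at e2
  by_cases hy0 : y ∈ dyadicCell j 0
  · rw [Set.indicator_of_mem hy0] at e2; norm_num at e2
  · rw [Set.indicator_of_notMem hy0] at e2; norm_num at e2

/-- The formula for `h_m` holds for every `j` that represents `m`. -/
theorem bandwidth_piecewisePoly (r : Fin d → ℕ) (j : Fin d → ℤ) :
    bandwidth r (piecewisePoly r (dyadicPartition j)) =
      (2 : ℝ) ^ (-∑ i, j i) / ((2 * ((∑ i, r i : ℕ) : ℝ) ^ 2) ^ d * 4 ^ (d + 1)) := by
  have hm : ∃ j' : Fin d → ℤ, piecewisePoly r (dyadicPartition j') =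
      piecewisePoly r (dyadicPartition j) := ⟨j, rfl⟩
  rw [bandwidth, dif_pos hm]
  have hc : dyadicCell hm.choose 0 = dyadicCell j 0 :=
    (dyadicCell_subset_of_eq hm.choose_spec.symm).antisymm
      (dyadicCell_subset_of_eq hm.choose_spec)
  have hv := congrArg volume hc
  rw [volume_dyadicCell, volume_dyadicCell,
    ENNReal.ofReal_eq_ofReal_iff (by positivity) (by positivity)] at hv
  rw [hv]

end SupNorm

/-! Fix a point `x`, put `R = ∑ r i` and `N = 8 R ^ 2`. By Markov's inequality a polynomial of
degree at most `r i` is controlled on an interval by its averages over `N` equal subintervals, so by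
Hahn–Banach its value at `x i` is a combination of these averages with total weight at most `(1 - 4
(r i) ^ 2 / N)⁻¹`. Tensoring over the coordinates gives, for each scale vector `e`, a functional
`T_e` (`tensorAverageComb`) built from averages over subrectangles, with total weight at most 2.

Let `p` and `q` have scales `j` and `j'`. Then `T_j p = p x` and `T_j' q = q x`, while `T_(j ⊓ j') p
= T_j' p` and `T_(j ⊓ j') q = T_j q`. The cross terms cancel in `T_j + T_j' - T_(j ⊓ j')`, which
therefore sends `p - q` to `(p - q) x`; no common refinement, whose cells could be too small, is
needed.

The bandwidth is such that every subrectangle used has volume at least `4 h`. Each average is then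
at most `5/4 |p - q|_h`, so `|(p - q) x| ≤ 3 * 2 * 5/4 |p - q|_h = 15/2 |p - q|_h`, and `15/2` is
below the claimed constant. -/

/-! ### Markov's inequality on an interval -/

-- Among polynomials bounded by 1 on `[-1, 1]`, the Chebyshev polynomial has the largest derivative
-- at 1, namely `n ^ 2`.
open Polynomial in
theorem derivative_eval_one_le {n : ℕ} {P : ℝ[X]} (hP : P.natDegree ≤ n) {M : ℝ}
    (hM : 0 < M) (hb : ∀ x ∈ Set.Icc (-1 : ℝ) 1, |P.eval x| ≤ M) :
    P.derivative.eval 1 ≤ n ^ 2 * M := by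
  have h := Chebyshev.eval_iterate_derivative_le_of_forall_abs_le_one (n := n)
    (P := C M⁻¹ * P) (k := 1) (x := 1) le_rfl
    (natDegree_le_iff_degree_le.1 ((natDegree_C_mul_le _ _).trans hP)) fun x hx => by
      rw [eval_mul, eval_C, abs_mul, abs_inv, abs_of_pos hM, inv_mul_le_iff₀ hM, mul_one]
      exact hb x hx
  rw [Function.iterate_one, Chebyshev.derivative_T_eval_one, derivative_C_mul, eval_mul, eval_C,
    inv_mul_le_iff₀ hM] at h
  rw [mul_comm]
  exact_mod_cast h

open Polynomial in
theorem abs_derivative_eval_right_le {n : ℕ} {P : ℝ[X]} (hP : P.natDegree ≤ n) {M a b : ℝ}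
    (hab : a < b) (hM : 0 < M) (hb : ∀ x ∈ Set.Icc a b, |P.eval x| ≤ M) :
    |P.derivative.eval b| ≤ 2 * n ^ 2 * M / (b - a) := by
  have key : ∀ Q : ℝ[X], Q.natDegree ≤ n → (∀ x ∈ Set.Icc a b, |Q.eval x| ≤ M) →
      Q.derivative.eval b ≤ 2 * n ^ 2 * M / (b - a) := by
    intro Q hQ hQb
    have h := derivative_eval_one_le (n := n) (P := Q.comp (C ((b - a) / 2) * X + C ((a + b) / 2)))
      (by
        refine natDegree_comp_le.trans ?_
        calc _ ≤ n * 1 := Nat.mul_le_mul hQ natDegree_linear_le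
          _ = n := mul_one n) hM fun x hx => by
        rw [eval_comp]
        apply hQb
        simp only [eval_add, eval_mul, eval_C, eval_X]
        constructor <;> nlinarith [hx.1, hx.2]
    rw [derivative_comp] at h
    simp only [derivative_add, derivative_C_mul, derivative_C, derivative_X, eval_mul, eval_add,
      eval_comp, eval_C, eval_X, mul_one, add_zero] at h
    rw [show (b - a) / 2 + (a + b) / 2 = b by ring] at h
    rw [le_div_iff₀ (by linarith)]
    linarith
  refine abs_le.2 ⟨?_, key P hP hb⟩
  have := key (-P) (by rwa [natDegree_neg]) (by simpa using hb)
  simp only [derivative_neg, eval_neg] at this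
  linarith

open Polynomial in
/-- A form of the Markov brothers' inequality, with twice the optimal constant. -/
theorem abs_derivative_eval_le {n : ℕ} {P : ℝ[X]} (hP : P.natDegree ≤ n) {M a b x : ℝ}
    (hab : a < b) (hM : 0 < M) (hb : ∀ x ∈ Set.Icc a b, |P.eval x| ≤ M) (hx : x ∈ Set.Icc a b) :
    |P.derivative.eval x| ≤ 4 * n ^ 2 * M / (b - a) := by
  have aux : ∀ l : ℝ, (b - a) / 2 ≤ l → 2 * n ^ 2 * M / l ≤ 4 * n ^ 2 * M / (b - a) := by
    intro l hl
    rw [div_le_div_iff₀ (by linarith) (by linarith)]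
    have : 0 ≤ n ^ 2 * M := by positivity
    nlinarith
  -- `x` is an endpoint of both `[a, x]` and `[x, b]`. The endpoint bound on the longer one, of
  -- length at least `(b - a) / 2`, costs a factor 2.
  rcases le_total ((a + b) / 2) x with h | h
  · exact (abs_derivative_eval_right_le hP (a := a) (by linarith) hM
      fun y hy => hb y ⟨hy.1, hy.2.trans hx.2⟩).trans (aux _ (by linarith))
  · have := abs_derivative_eval_right_le (P := P.comp (-X)) (n := n) (a := -b) (b := -x)
      (by rw [natDegree_comp, natDegree_neg, natDegree_X, mul_one]; exact hP)
      (by linarith) hM fun y hy => by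
        rw [eval_comp, eval_neg, eval_X]
        exact hb _ ⟨by linarith [hy.2, hx.1], by linarith [hy.1]⟩
    rw [derivative_comp] at this
    simp only [derivative_neg, derivative_X, eval_neg, eval_comp, eval_X,
      neg_neg, neg_mul, one_mul, abs_neg] at this
    exact this.trans (aux _ (by linarith))

/-! ### Polynomial values from averages over subintervals -/

/-- The `s`-th of the `N` consecutive open subintervals of equal length of `(a, a + l)`. -/
def subinterval (a l : ℝ) (N : ℕ) (s : Fin N) : Set ℝ :=
  Set.Ioo (a + l * (s / N)) (a + l * ((s + 1) / N))

theorem subinterval_length (a l : ℝ) {N : ℕ} (s : Fin N) :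
    a + l * ((s + 1) / N) - (a + l * (s / N)) = l / N := by ring

open Polynomial in
theorem integrableOn_eval_subinterval (P : ℝ[X]) (a l : ℝ) {N : ℕ} (s : Fin N) :
    IntegrableOn (fun x => P.eval x) (subinterval a l N s) :=
  (P.continuous.integrableOn_Icc).mono_set Set.Ioo_subset_Icc_self

theorem mem_subinterval_bounds {a l x : ℝ} (hl : 0 < l) {N : ℕ} {s : Fin N}
    (hx : x ∈ subinterval a l N s) : x ∈ Set.Ioo a (a + l) := by
  have hN : (0 : ℝ) < N := by exact_mod_cast s.pos
  have hs : (s + 1 : ℝ) / N ≤ 1 := by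
    rw [div_le_one hN]; exact_mod_cast s.2
  have hs0 : (0 : ℝ) ≤ s / N := by positivity
  exact ⟨lt_of_le_of_lt (by nlinarith) hx.1, lt_of_lt_of_le hx.2 (by nlinarith)⟩

theorem exists_mem_closure_subinterval {a l t : ℝ} (hl : 0 < l) {N : ℕ} (hN : 0 < N)
    (ht : t ∈ Set.Icc a (a + l)) :
    ∃ s : Fin N, t ∈ Set.Icc (a + l * (s / N)) (a + l * ((s + 1) / N)) := by
  have hN' : (0 : ℝ) < N := by exact_mod_cast hN
  -- At the right endpoint the floor used below would be `N`, out of range; the last subinterval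
  -- serves instead.
  rcases ht.2.eq_or_lt with h | h
  · refine ⟨⟨N - 1, by omega⟩, ?_⟩
    have : ((N - 1 : ℕ) : ℝ) = N - 1 := by rw [Nat.cast_sub hN]; simp
    simp only [this, h]
    constructor
    · have : ((N : ℝ) - 1) / N ≤ 1 := by rw [div_le_one hN']; linarith
      nlinarith
    · rw [sub_add_cancel, div_self hN'.ne', mul_one]
  · have h0 : 0 ≤ (t - a) / l * N := by
      have := ht.1
      have : 0 ≤ t - a := by linarith
      positivity
    have hlt : (t - a) / l * N < N := by
      have : (t - a) / l < 1 := by rw [div_lt_one hl]; linarith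
      nlinarith
    refine ⟨⟨⌊(t - a) / l * N⌋₊, (Nat.floor_lt h0).2 hlt⟩, ?_⟩
    have e : t = a + l * ((t - a) / l * N / N) := by field_simp; ring
    constructor
    · conv_rhs => rw [e]
      gcongr
      exact Nat.floor_le h0
    · conv_lhs => rw [e]
      gcongr
      exact (Nat.lt_floor_add_one _).le

-- Let `|P|` be maximal at `z`. Markov's inequality bounds the slope by `4 n ^ 2 |P z| / l`, so the
-- average over a subinterval of length `l / N` adjacent to `z` differs from `P z` by at most `4 n ^
-- 2 / N * |P z|`.
open Polynomial in
theorem abs_eval_le_of_abs_average_le {n N : ℕ} (hN : 4 * n ^ 2 < N) {P : ℝ[X]}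
    (hP : P.natDegree ≤ n) {a l m : ℝ} (hl : 0 < l)
    (hm : ∀ s : Fin N, |N / l * ∫ x in subinterval a l N s, P.eval x| ≤ m) {t : ℝ}
    (ht : t ∈ Set.Icc a (a + l)) : |P.eval t| ≤ (1 - 4 * n ^ 2 / N : ℝ)⁻¹ * m := by
  have hN0 : 0 < N := by omega
  have hN' : (0 : ℝ) < N := by exact_mod_cast hN0
  have hNr : (4 * n ^ 2 : ℝ) < N := by exact_mod_cast hN
  have hθ : (4 * n ^ 2 : ℝ) / N < 1 := by rwa [div_lt_one hN']
  obtain ⟨z, hz, hmax⟩ := isCompact_Icc.exists_isMaxOn (Set.nonempty_Icc.2 (by linarith))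
    (P.continuous.abs.continuousOn (s := Set.Icc a (a + l)))
  have hmax' : ∀ x ∈ Set.Icc a (a + l), |P.eval x| ≤ |P.eval z| := fun x hx => hmax hx
  refine (hmax' t ht).trans ?_
  rw [le_inv_mul_iff₀ (by linarith)]
  obtain ⟨s, hs⟩ := exists_mem_closure_subinterval hl hN0 hz
  refine le_trans ?_ (hm s)
  -- The derivative bound requires a positive bound on `|P|`.
  rcases (abs_nonneg (P.eval z)).eq_or_lt with h0 | hpos
  · rw [← h0, mul_zero]; positivity
  set D := 4 * n ^ 2 * |P.eval z| / l with hD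
  have hder : ∀ x ∈ Set.Icc a (a + l), ‖P.derivative.eval x‖ ≤ D := fun x hx => by
    have := abs_derivative_eval_le hP (by linarith : a < a + l) hpos hmax' hx
    rwa [add_sub_cancel_left] at this
  have hlip : ∀ x ∈ subinterval a l N s, ‖P.eval x - P.eval z‖ ≤ D * (l / N) := fun x hx => by
    have hx' := Set.Ioo_subset_Icc_self (mem_subinterval_bounds hl hx)
    refine ((convex_Icc a (a + l)).norm_image_sub_le_of_norm_hasDerivWithin_le
      (f := fun x => P.eval x) (fun y _ => (P.hasDerivAt y).hasDerivWithinAt) hder hz hx').trans ?_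
    have hD0 : 0 ≤ D := by positivity
    refine mul_le_mul_of_nonneg_left ?_ hD0
    rw [Real.norm_eq_abs, abs_le, ← subinterval_length a l s]
    constructor <;> linarith [hx.1, hx.2, hs.1, hs.2]
  have hvol : volume.real (subinterval a l N s) = l / N := by
    rw [subinterval, Real.volume_real_Ioo_of_le, subinterval_length]
    linarith [subinterval_length a l s, div_pos hl hN']
  have hvt : volume (subinterval a l N s) < ⊤ := by rw [subinterval]; exact measure_Ioo_lt_top
  have hint := norm_setIntegral_le_of_norm_le_const hvt hlip
  rw [integral_sub (integrableOn_eval_subinterval P _ _ _) (integrableOn_const hvt.ne),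
    setIntegral_const, hvol,
    smul_eq_mul] at hint
  have hmul := mul_le_mul_of_nonneg_left hint (by positivity : (0 : ℝ) ≤ N / l)
  rw [← abs_of_pos (by positivity : (0 : ℝ) < N / l), Real.norm_eq_abs, ← abs_mul, mul_sub,
    abs_of_pos (by positivity : (0 : ℝ) < N / l)] at hmul
  have e1 : N / l * (l / N * P.eval z) = P.eval z := by field_simp
  have e2 : N / l * (D * (l / N) * (l / N)) = 4 * n ^ 2 / N * |P.eval z| := by
    rw [hD]; field_simp
  rw [e1, e2, abs_sub_comm] at hmul
  have := abs_sub_abs_le_abs_sub (P.eval z) (N / l * ∫ x in subinterval a l N s, P.eval x)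
  linarith

/-- A linear functional that is controlled by finitely many others is a combination of them
with controlled weights. -/
theorem exists_weights_of_abs_le {V ι : Type*} [AddCommGroup V] [Module ℝ V] [Fintype ι]
    (A : V →ₗ[ℝ] ι → ℝ) (φ : V →ₗ[ℝ] ℝ) {c : ℝ} (hc : 0 ≤ c)
    (h : ∀ v, |φ v| ≤ c * ‖A v‖) :
    ∃ w : ι → ℝ, ∑ s, |w s| ≤ c ∧ ∀ v, ∑ s, w s * A v s = φ v := by
  classical
  -- The bound makes `φ` vanish on the kernel of `A`, so `φ` factors through `A`.
  have hφ : φ ∈ LinearMap.range A.dualMap := by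
    rw [LinearMap.range_dualMap_eq_dualAnnihilator_ker, Submodule.mem_dualAnnihilator]
    intro v hv
    rw [LinearMap.mem_ker] at hv
    simpa [hv] using h v
  obtain ⟨ψ, hψ⟩ := hφ
  have hψ' : ∀ v, ψ (A v) = φ v := fun v => by rw [← hψ]; rfl
  let f : StrongDual ℝ (LinearMap.range A) :=
    (ψ.comp (LinearMap.range A).subtype).mkContinuous c (by
      rintro ⟨_, v, rfl⟩
      simpa [hψ'] using h v)
  -- Hahn–Banach, for the sup norm on `ι → ℝ`.
  obtain ⟨g, hg, hgn⟩ := exists_extension_norm_eq (LinearMap.range A) f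
  have hgc : ‖g‖ ≤ c := hgn.le.trans (LinearMap.mkContinuous_norm_le _ hc _)
  have hsum : ∀ x : ι → ℝ, g x = ∑ s, g (Pi.single s 1) * x s := fun x => by
    conv_lhs => rw [pi_eq_sum_univ' x, map_sum]
    refine Finset.sum_congr rfl fun s _ => ?_
    rw [map_smul, smul_eq_mul, mul_comm]
  refine ⟨fun s => g (Pi.single s 1), ?_, fun v => ?_⟩
  -- The dual of the sup norm is the `ℓ¹` norm: `g` is tested on the sign vector of its own
  -- coefficients.
  · have := g.le_opNorm fun s => (SignType.sign (g (Pi.single s 1)) : ℝ)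
    rw [hsum] at this
    simp only [self_mul_sign] at this
    refine (le_abs_self _).trans (this.trans ?_)
    refine (mul_le_of_le_one_right (norm_nonneg _) ?_).trans hgc
    refine (pi_norm_le_iff_of_nonneg zero_le_one).2 fun s => ?_
    rcases SignType.sign (g (Pi.single s 1)) with _ | _ | _ <;> simp
  · rw [← hsum, ← hψ']
    exact hg ⟨A v, v, rfl⟩

open Polynomial in
/-- The value of a polynomial at a point of an interval is a combination with small weights of its
averages over subintervals. -/
theorem exists_weights_subinterval {n N : ℕ} (hN : 4 * n ^ 2 < N) {a l t : ℝ} (hl : 0 < l)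
    (ht : t ∈ Set.Icc a (a + l)) :
    ∃ w : Fin N → ℝ, ∑ s, |w s| ≤ (1 - 4 * n ^ 2 / N : ℝ)⁻¹ ∧ ∀ P : ℝ[X], P.natDegree ≤ n →
      ∑ s, w s * (N / l * ∫ x in subinterval a l N s, P.eval x) = P.eval t := by
  have hN' : (0 : ℝ) < N := by exact_mod_cast (by omega : 0 < N)
  have hNr : (4 * n ^ 2 : ℝ) < N := by exact_mod_cast hN
  have hθ : (4 * n ^ 2 : ℝ) / N < 1 := by rwa [div_lt_one hN']
  let A : degreeLE ℝ n →ₗ[ℝ] Fin N → ℝ :=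
    { toFun := fun P s => N / l * ∫ x in subinterval a l N s, (P : ℝ[X]).eval x
      map_add' := fun P Q => by
        ext s
        simp only [Submodule.coe_add, eval_add, Pi.add_apply]
        rw [integral_add (integrableOn_eval_subinterval _ _ _ _)
          (integrableOn_eval_subinterval _ _ _ _), mul_add]
      map_smul' := fun c P => by
        ext s
        simp only [Submodule.coe_smul, eval_smul, Pi.smul_apply, smul_eq_mul, RingHom.id_apply]
        rw [integral_const_mul]
        ring }
  have hc : 0 ≤ (1 - 4 * n ^ 2 / N : ℝ)⁻¹ := inv_nonneg.2 (by linarith)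
  obtain ⟨w, hw, hwP⟩ := exists_weights_of_abs_le A
    ((leval t).comp (degreeLE ℝ n).subtype) hc fun P =>
      abs_eval_le_of_abs_average_le hN (natDegree_le_iff_degree_le.2 (mem_degreeLE.1 P.2)) hl
        (fun s => norm_le_pi_norm (A P) s) ht
  exact ⟨w, hw, fun P hP => hwP ⟨P, mem_degreeLE.2 (natDegree_le_iff_degree_le.1 hP)⟩⟩

/-! ### Dyadic intervals and monomials on them -/

/-- The left endpoint of the dyadic interval of length `2 ^ (-e)` that contains `x`. -/
noncomputable def dyadicLeft (e : ℤ) (x : ℝ) : ℝ := ⌊x * 2 ^ e⌋ * 2 ^ (-e)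

/-- The monomial `x ^ a`, restricted to the dyadic interval `[k 2 ^ (-e), (k + 1) 2 ^ (-e))`. -/
noncomputable def cellMonomial (e k : ℤ) (a : ℕ) : ℝ → ℝ :=
  (Set.Ico ((k : ℝ) * 2 ^ (-e)) (((k : ℝ) + 1) * 2 ^ (-e))).indicator fun x => x ^ a

theorem mem_dyadic_iff {e k : ℤ} {x : ℝ} :
    x ∈ Set.Ico ((k : ℝ) * 2 ^ (-e)) (((k : ℝ) + 1) * 2 ^ (-e)) ↔ ⌊x * 2 ^ e⌋ = k := by
  have h : (0 : ℝ) < 2 ^ e := by positivity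
  rw [Int.floor_eq_iff, zpow_neg, Set.mem_Ico, ← div_eq_mul_inv, ← div_eq_mul_inv, div_le_iff₀ h,
    lt_div_iff₀ h]

theorem cellMonomial_apply (e k : ℤ) (a : ℕ) (x : ℝ) :
    cellMonomial e k a x = if ⌊x * 2 ^ e⌋ = k then x ^ a else 0 := by
  classical
  rw [cellMonomial, Set.indicator_apply]
  simp only [mem_dyadic_iff]

theorem mem_Icc_dyadicLeft (e : ℤ) (x : ℝ) :
    x ∈ Set.Icc (dyadicLeft e x) (dyadicLeft e x + 2 ^ (-e)) := by
  have := (mem_dyadic_iff (e := e) (x := x)).2 rfl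
  rw [add_mul, one_mul] at this
  exact Set.Ico_subset_Icc_self this

theorem floor_eq_of_mem {e : ℤ} {x y : ℝ}
    (hy : y ∈ Set.Ioo (dyadicLeft e x) (dyadicLeft e x + 2 ^ (-e))) :
    ⌊y * 2 ^ e⌋ = ⌊x * 2 ^ e⌋ := by
  rw [← mem_dyadic_iff, add_mul, one_mul]
  exact Set.Ioo_subset_Ico_self hy

/-- Dyadic intervals are nested: the floor of `z / 2 ^ n` depends only on the floor of `z`. -/
theorem floor_eq_of_floor_eq {e e' : ℤ} (h : e ≤ e') {x y : ℝ}
    (hxy : ⌊y * 2 ^ e'⌋ = ⌊x * 2 ^ e'⌋) : ⌊y * 2 ^ e⌋ = ⌊x * 2 ^ e⌋ := by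
  obtain ⟨n, rfl⟩ := Int.le.dest h
  have key : ∀ z : ℝ, z * 2 ^ e = z * 2 ^ (e + n) / ((2 ^ n : ℕ) : ℝ) := fun z => by
    rw [zpow_add₀ two_ne_zero, zpow_natCast]
    push_cast
    field_simp
  rw [key, key x, Int.floor_div_natCast, Int.floor_div_natCast, hxy]

theorem integrable_cellMonomial (e k : ℤ) (a : ℕ) : Integrable (cellMonomial e k a) := by
  rw [cellMonomial, integrable_indicator_iff measurableSet_Ico]
  exact ((continuous_pow a).integrableOn_Icc).mono_set Set.Ico_subset_Icc_self

theorem exists_abs_cellMonomial_le (e k : ℤ) (a : ℕ) : ∃ M, ∀ x, |cellMonomial e k a x| ≤ M := by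
  obtain ⟨M, hM⟩ := (isCompact_Icc (a := (k : ℝ) * 2 ^ (-e))
    (b := (k + 1) * 2 ^ (-e))).exists_bound_of_continuousOn
      (continuous_pow a (M := ℝ)).continuousOn
  refine ⟨|M|, fun x => ?_⟩
  rw [cellMonomial, Set.indicator_apply]
  split_ifs with h
  · exact (hM x (Set.Ico_subset_Icc_self h)).trans (le_abs_self M)
  · simp

/-! ### Tensor products of averaging functionals -/

variable {d : ℕ}

/-- The combination with weights `w` of the averages of `φ` over the `N` subintervals of the
dyadic interval of length `2 ^ (-e)` that contains `x`. -/
noncomputable def averageComb {N : ℕ} (w : Fin N → ℝ) (e : ℤ) (x : ℝ) (φ : ℝ → ℝ) : ℝ :=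
  ∑ s, w s * (N / 2 ^ (-e) * ∫ y in subinterval (dyadicLeft e x) (2 ^ (-e)) N s, φ y)

/-- A product of subintervals of the dyadic cell with side lengths `2 ^ (-e i)` that
contains `x`. -/
def subrectangle {N : ℕ} (e : Fin d → ℤ) (x : Fin d → ℝ) (s : Fin d → Fin N) :
    Set (Fin d → ℝ) :=
  Set.univ.pi fun i => subinterval (dyadicLeft (e i) (x i)) (2 ^ (-e i)) N (s i)

/-- The combination with product weights of the averages of `f` over the subrectangles of the
dyadic cell with side lengths `2 ^ (-e i)` that contains `x`. -/
noncomputable def tensorAverageComb {N : ℕ} (w : Fin d → Fin N → ℝ) (e : Fin d → ℤ)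
    (x : Fin d → ℝ) (f : (Fin d → ℝ) → ℝ) : ℝ :=
  ∑ s : Fin d → Fin N, (∏ i, w i (s i)) *
    ((∏ i, (N / 2 ^ (-e i) : ℝ)) * ∫ y in subrectangle e x s, f y)

/-- When `e ≤ e'`, the interval of scale `e'` around `x` lies in a single interval of scale `e`, so
the averages see either the polynomial `X ^ a` or zero. -/
theorem averageComb_cellMonomial {n N : ℕ} {w : Fin N → ℝ} {e' : ℤ} {x : ℝ}
    (hw : ∀ P : Polynomial ℝ, P.natDegree ≤ n → ∑ s, w s *
      (N / 2 ^ (-e') * ∫ y in subinterval (dyadicLeft e' x) (2 ^ (-e')) N s, P.eval y) = P.eval x)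
    {e k : ℤ} {a : ℕ} (ha : a ≤ n) (he : e ≤ e') :
    averageComb w e' x (cellMonomial e k a) = cellMonomial e k a x := by
  have key : averageComb w e' x (cellMonomial e k a) =
      ∑ s, w s * (N / 2 ^ (-e') * ∫ y in subinterval (dyadicLeft e' x) (2 ^ (-e')) N s,
        (if ⌊x * 2 ^ e⌋ = k then Polynomial.X ^ a else 0 : Polynomial ℝ).eval y) := by
    refine Finset.sum_congr rfl fun s _ => ?_
    congr 2
    refine setIntegral_congr_fun measurableSet_Ioo fun y hy => ?_
    have hy' := floor_eq_of_floor_eq he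
      (floor_eq_of_mem (mem_subinterval_bounds (by positivity) hy))
    simp only [cellMonomial_apply, hy']
    split_ifs <;> simp
  rw [key, hw _ (by split_ifs <;> simp [ha]), cellMonomial_apply]
  split_ifs <;> simp

theorem tensorAverageComb_prod {N : ℕ} (w : Fin d → Fin N → ℝ) (e : Fin d → ℤ)
    (x : Fin d → ℝ) (φ : Fin d → ℝ → ℝ) :
    tensorAverageComb w e x (fun y => ∏ i, φ i (y i)) =
      ∏ i, averageComb (w i) (e i) (x i) (φ i) := by
  simp only [averageComb]
  rw [Finset.prod_univ_sum, Fintype.piFinset_univ]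
  refine Finset.sum_congr rfl fun s _ => ?_
  rw [Finset.prod_mul_distrib, Finset.prod_mul_distrib, subrectangle, volume_pi,
    Measure.restrict_pi_pi, integral_fintype_prod_eq_prod]

theorem tensorAverageComb_add {N : ℕ} (w : Fin d → Fin N → ℝ) (e : Fin d → ℤ)
    (x : Fin d → ℝ) {f g : (Fin d → ℝ) → ℝ} (hf : Integrable f) (hg : Integrable g) :
    tensorAverageComb w e x (f + g) =
      tensorAverageComb w e x f + tensorAverageComb w e x g := by
  simp only [tensorAverageComb, ← Finset.sum_add_distrib, ← mul_add]
  refine Finset.sum_congr rfl fun s _ => ?_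
  rw [← integral_add hf.integrableOn hg.integrableOn]
  rfl

theorem tensorAverageComb_smul {N : ℕ} (w : Fin d → Fin N → ℝ) (e : Fin d → ℤ)
    (x : Fin d → ℝ) (c : ℝ) (f : (Fin d → ℝ) → ℝ) :
    tensorAverageComb w e x (c • f) = c * tensorAverageComb w e x f := by
  simp only [tensorAverageComb, Finset.mul_sum, Pi.smul_apply, smul_eq_mul, integral_const_mul]
  refine Finset.sum_congr rfl fun s _ => ?_
  ring

theorem tensorAverageComb_sub {N : ℕ} (w : Fin d → Fin N → ℝ) (e : Fin d → ℤ)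
    (x : Fin d → ℝ) {f g : (Fin d → ℝ) → ℝ} (hf : Integrable f) (hg : Integrable g) :
    tensorAverageComb w e x (f - g) =
      tensorAverageComb w e x f - tensorAverageComb w e x g := by
  rw [sub_eq_add_neg, ← neg_one_smul ℝ g, tensorAverageComb_add w e x hf (hg.smul _),
    tensorAverageComb_smul]
  ring

theorem abs_tensorAverageComb_le {N : ℕ} {w : Fin d → Fin N → ℝ} {e : Fin d → ℤ}
    {x : Fin d → ℝ} {f : (Fin d → ℝ) → ℝ} {B : ℝ}
    (hB : ∀ s : Fin d → Fin N,
      |(∏ i, (N / 2 ^ (-e i) : ℝ)) * ∫ y in subrectangle e x s, f y| ≤ B) :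
    |tensorAverageComb w e x f| ≤ (∏ i, ∑ s, |w i s|) * B := by
  rw [Finset.prod_univ_sum, Fintype.piFinset_univ, Finset.sum_mul]
  refine (Finset.abs_sum_le_sum_abs _ _).trans (Finset.sum_le_sum fun s _ => ?_)
  rw [abs_mul, Finset.abs_prod]
  exact mul_le_mul_of_nonneg_left (hB s) (Finset.prod_nonneg fun i _ => abs_nonneg _)

/-! ### Reduction of the models to products of monomials -/

/-- The products of monomials, of degree at most `r i` in the `i`-th variable, restricted to the
cells of the dyadic partition. -/
def cellMonomials (r : Fin d → ℕ) (j : Fin d → ℤ) : Set ((Fin d → ℝ) → ℝ) :=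
  {f | ∃ (k : Fin d → ℤ) (a : Fin d → ℕ), (∀ i, a i ≤ r i) ∧
    f = fun x => ∏ i, cellMonomial (j i) (k i) (a i) (x i)}

/-- Identities linear in `f` need only be checked on products of one-variable functions, where the
tensor functional factors. -/
theorem piecewisePoly_subset_span (r : Fin d → ℕ) (j : Fin d → ℤ) :
    SupNorm.piecewisePoly r (SupNorm.dyadicPartition j) ⊆
      Submodule.span ℝ (cellMonomials r j) := by
  classical
  rintro f ⟨P, hdeg, hfin, hf⟩
  have hmem : ∀ (x : Fin d → ℝ) (k : Fin d → ℤ),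
      x ∈ SupNorm.dyadicCell j k ↔ (fun i => ⌊x i * 2 ^ j i⌋) = k := fun x k => by
    simp only [SupNorm.dyadicCell, Set.mem_univ_pi, mem_dyadic_iff, funext_iff]
  have hsum : f = ∑ I ∈ hfin.toFinset, ∑ m ∈ (P I).support,
      (((P I).coeff m : ℚ) : ℝ) • I.indicator fun x : Fin d → ℝ => ∏ i, x i ^ m i := by
    funext x
    set I₀ := SupNorm.dyadicCell j fun i => ⌊x i * 2 ^ j i⌋ with hI₀
    have hxI₀ : x ∈ I₀ := (hmem _ _).2 rfl
    have hI₀mem : I₀ ∈ SupNorm.dyadicPartition j := ⟨_, rfl⟩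
    simp only [Finset.sum_apply, Pi.smul_apply, smul_eq_mul]
    rw [Finset.sum_eq_single I₀]
    · rw [hf I₀ hI₀mem x hxI₀, MvPolynomial.aeval_eq_eval₂Hom, MvPolynomial.coe_eval₂Hom,
        MvPolynomial.eval₂_eq']
      simp [Set.indicator_of_mem hxI₀]
    · intro I hI hne
      obtain ⟨⟨k, rfl⟩, -⟩ := hfin.mem_toFinset.1 hI
      have hx : x ∉ SupNorm.dyadicCell j k := fun hx => hne (by rw [hI₀, (hmem x k).1 hx])
      simp [Set.indicator_of_notMem hx]
    · intro hI
      have : P I₀ = 0 := by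
        by_contra h
        exact hI (hfin.mem_toFinset.2 ⟨hI₀mem, h⟩)
      simp [this]
  rw [hsum]
  refine Submodule.sum_mem _ fun I hI => Submodule.sum_mem _ fun m hm => Submodule.smul_mem _ _ ?_
  obtain ⟨hI, -⟩ := hfin.mem_toFinset.1 hI
  refine Submodule.subset_span ?_
  have hmr : ∀ i, m i ≤ r i := fun i => (MvPolynomial.monomial_le_degreeOf i hm).trans (hdeg I hI i)
  obtain ⟨k, rfl⟩ := hI
  refine ⟨k, m, hmr, funext fun x => ?_⟩
  rw [Set.indicator_apply]
  simp only [cellMonomial_apply, hmem, funext_iff]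
  split_ifs with h
  · exact Finset.prod_congr rfl fun i _ => (if_pos (h i)).symm
  · push Not at h
    obtain ⟨i, hi⟩ := h
    exact (Finset.prod_eq_zero (Finset.mem_univ i) (if_neg hi)).symm

theorem integrable_of_mem_span {r : Fin d → ℕ} {j : Fin d → ℤ} {f : (Fin d → ℝ) → ℝ}
    (hf : f ∈ Submodule.span ℝ (cellMonomials r j)) : Integrable f := by
  induction hf using Submodule.span_induction with
  | mem f hf =>
    obtain ⟨k, a, -, rfl⟩ := hf
    exact Integrable.fintype_prod fun i => integrable_cellMonomial (j i) (k i) (a i)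
  | zero => exact integrable_zero _ _ _
  | add f g _ _ hf hg => exact hf.add hg
  | smul c f _ hf => exact hf.smul c

theorem exists_abs_le_of_mem_span {r : Fin d → ℕ} {j : Fin d → ℤ} {f : (Fin d → ℝ) → ℝ}
    (hf : f ∈ Submodule.span ℝ (cellMonomials r j)) : ∃ M, ∀ x, |f x| ≤ M := by
  induction hf using Submodule.span_induction with
  | mem f hf =>
    obtain ⟨k, a, -, rfl⟩ := hf
    choose M hM using fun i => exists_abs_cellMonomial_le (j i) (k i) (a i)
    refine ⟨∏ i, M i, fun x => ?_⟩
    rw [Finset.abs_prod]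
    exact Finset.prod_le_prod (fun i _ => abs_nonneg _) fun i _ => hM i (x i)
  | zero => exact ⟨0, fun x => by simp⟩
  | add f g _ _ hf hg =>
    obtain ⟨M, hM⟩ := hf
    obtain ⟨M', hM'⟩ := hg
    exact ⟨M + M', fun x => (abs_add_le _ _).trans (add_le_add (hM x) (hM' x))⟩
  | smul c f _ hf =>
    obtain ⟨M, hM⟩ := hf
    refine ⟨|c| * M, fun x => ?_⟩
    rw [Pi.smul_apply, smul_eq_mul, abs_mul]
    exact mul_le_mul_of_nonneg_left (hM x) (abs_nonneg c)

/-! ### The reproducing identity for differences -/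

section Weights

variable {N : ℕ} {r : Fin d → ℕ} {x : Fin d → ℝ} {W : Fin d → ℤ → Fin N → ℝ}

theorem tensorAverageComb_eq_apply
    (hW : ∀ i e, ∀ P : Polynomial ℝ, P.natDegree ≤ r i → ∑ s, W i e s * (N / 2 ^ (-e) *
      ∫ y in subinterval (dyadicLeft e (x i)) (2 ^ (-e)) N s, P.eval y) = P.eval (x i))
    {j : Fin d → ℤ} {f : (Fin d → ℝ) → ℝ} (hf : f ∈ Submodule.span ℝ (cellMonomials r j)) :
    tensorAverageComb (fun i => W i (j i)) j x f = f x := by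
  induction hf using Submodule.span_induction with
  | mem f hf =>
    obtain ⟨k, a, ha, rfl⟩ := hf
    rw [tensorAverageComb_prod]
    exact Finset.prod_congr rfl fun i _ => averageComb_cellMonomial (hW i (j i)) (ha i) le_rfl
  | zero => simp [tensorAverageComb]
  | add f g hf hg ihf ihg =>
    rw [tensorAverageComb_add _ _ _ (integrable_of_mem_span hf) (integrable_of_mem_span hg),
      ihf, ihg, Pi.add_apply]
  | smul c f _ ih => rw [tensorAverageComb_smul, ih, Pi.smul_apply, smul_eq_mul]

/-- Both sides factor over the coordinates. If `j i ≤ j' i`, both factors reproduce the value at `x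
i`; otherwise the two scales coincide, and so do the weights, since `W` depends only on the
coordinate and the scale there. -/
theorem tensorAverageComb_inf_eq
    (hW : ∀ i e, ∀ P : Polynomial ℝ, P.natDegree ≤ r i → ∑ s, W i e s * (N / 2 ^ (-e) *
      ∫ y in subinterval (dyadicLeft e (x i)) (2 ^ (-e)) N s, P.eval y) = P.eval (x i))
    {j : Fin d → ℤ} (j' : Fin d → ℤ) {f : (Fin d → ℝ) → ℝ}
    (hf : f ∈ Submodule.span ℝ (cellMonomials r j)) :
    tensorAverageComb (fun i => W i ((j ⊓ j') i)) (j ⊓ j') x f =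
      tensorAverageComb (fun i => W i (j' i)) j' x f := by
  induction hf using Submodule.span_induction with
  | mem f hf =>
    obtain ⟨k, a, ha, rfl⟩ := hf
    rw [tensorAverageComb_prod, tensorAverageComb_prod]
    refine Finset.prod_congr rfl fun i _ => ?_
    rcases le_total (j i) (j' i) with h | h
    · rw [Pi.inf_apply, inf_of_le_left h, averageComb_cellMonomial (hW i _) (ha i) le_rfl,
        averageComb_cellMonomial (hW i _) (ha i) h]
    · rw [Pi.inf_apply, inf_of_le_right h]
  | zero => simp [tensorAverageComb]
  | add f g hf hg ihf ihg =>
    rw [tensorAverageComb_add _ _ _ (integrable_of_mem_span hf) (integrable_of_mem_span hg),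
      ihf, ihg, tensorAverageComb_add _ _ _ (integrable_of_mem_span hf) (integrable_of_mem_span hg)]
  | smul c f _ ih => rw [tensorAverageComb_smul, ih, tensorAverageComb_smul]

theorem sub_apply_eq_tensorAverageComb
    (hW : ∀ i e, ∀ P : Polynomial ℝ, P.natDegree ≤ r i → ∑ s, W i e s * (N / 2 ^ (-e) *
      ∫ y in subinterval (dyadicLeft e (x i)) (2 ^ (-e)) N s, P.eval y) = P.eval (x i))
    {j j' : Fin d → ℤ} {p q : (Fin d → ℝ) → ℝ}
    (hp : p ∈ Submodule.span ℝ (cellMonomials r j))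
    (hq : q ∈ Submodule.span ℝ (cellMonomials r j')) :
    (p - q) x = tensorAverageComb (fun i => W i (j i)) j x (p - q) +
      tensorAverageComb (fun i => W i (j' i)) j' x (p - q) -
      tensorAverageComb (fun i => W i ((j ⊓ j') i)) (j ⊓ j') x (p - q) := by
  have hpi := integrable_of_mem_span hp
  have hqi := integrable_of_mem_span hq
  have h := tensorAverageComb_inf_eq hW j hq
  rw [inf_comm] at h
  simp only [tensorAverageComb_sub _ _ _ hpi hqi, tensorAverageComb_eq_apply hW hp,
    tensorAverageComb_eq_apply hW hq, tensorAverageComb_inf_eq hW j' hp, h, Pi.sub_apply]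
  ring

end Weights

/-! ### Constants and volumes -/

theorem one_sub_sum_le_prod_one_sub {ι : Type*} (s : Finset ι) {u : ι → ℝ}
    (h0 : ∀ i ∈ s, 0 ≤ u i) (h1 : ∀ i ∈ s, u i ≤ 1) :
    1 - ∑ i ∈ s, u i ≤ ∏ i ∈ s, (1 - u i) := by
  induction s using Finset.cons_induction with
  | empty => simp
  | cons a s ha ih =>
    rw [Finset.sum_cons, Finset.prod_cons]
    have ih' := ih (fun i hi => h0 i (Finset.mem_cons_of_mem hi))
      fun i hi => h1 i (Finset.mem_cons_of_mem hi)
    have hp : ∏ i ∈ s, (1 - u i) ≤ 1 := Finset.prod_le_one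
      (fun i hi => sub_nonneg.2 (h1 i (Finset.mem_cons_of_mem hi)))
      fun i hi => sub_le_self _ (h0 i (Finset.mem_cons_of_mem hi))
    nlinarith [h0 a (Finset.mem_cons_self a s)]

theorem sum_pos_of_ne_zero {r : Fin d → ℕ} (hr : r ≠ 0) : 0 < ∑ i, r i := by
  obtain ⟨i, hi⟩ := Function.ne_iff.1 hr
  exact (Nat.pos_of_ne_zero hi).trans_le
    (Finset.single_le_sum (f := r) (fun _ _ => Nat.zero_le _) (Finset.mem_univ i))

theorem four_mul_sq_lt {r : Fin d → ℕ} (hr : r ≠ 0) (i : Fin d) :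
    4 * r i ^ 2 < 8 * (∑ i, r i) ^ 2 := by
  have h1 : r i ≤ ∑ i, r i :=
    Finset.single_le_sum (f := r) (fun _ _ => Nat.zero_le _) (Finset.mem_univ i)
  have h2 := sum_pos_of_ne_zero hr
  nlinarith

/-- Since `∑ (r i) ^ 2 ≤ (∑ r i) ^ 2`, the numbers `u i = 4 (r i) ^ 2 / N` sum to at most `1/2`,
hence `∏ (1 - u i) ≥ 1/2`. Choosing `N` of order `(∑ r i) ^ 2` keeps this bound free of `d`. -/
theorem prod_inv_le_two {r : Fin d → ℕ} (hr : r ≠ 0) :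
    ∏ i, (1 - 4 * (r i : ℝ) ^ 2 / (8 * (∑ i, r i) ^ 2 : ℕ))⁻¹ ≤ 2 := by
  have hN : (0 : ℝ) < (8 * (∑ i, r i) ^ 2 : ℕ) := by
    have := sum_pos_of_ne_zero hr
    positivity
  have hle : ∀ i, 4 * (r i : ℝ) ^ 2 / (8 * (∑ i, r i) ^ 2 : ℕ) ≤ 1 := fun i => by
    rw [div_le_one hN]
    exact_mod_cast (four_mul_sq_lt hr i).le
  have hsum : ∑ i, 4 * (r i : ℝ) ^ 2 / (8 * (∑ i, r i) ^ 2 : ℕ) ≤ 1 / 2 := by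
    rw [← Finset.sum_div, ← Finset.mul_sum, div_le_iff₀ hN]
    have := Finset.sum_sq_le_sq_sum_of_nonneg (s := Finset.univ) (f := fun i => (r i : ℝ))
      fun i _ => Nat.cast_nonneg _
    push_cast
    linarith
  have := one_sub_sum_le_prod_one_sub Finset.univ
    (u := fun i => 4 * (r i : ℝ) ^ 2 / (8 * (∑ i, r i) ^ 2 : ℕ))
    (fun i _ => by positivity) fun i _ => hle i
  rw [Finset.prod_inv_distrib]
  refine inv_le_of_inv_le₀ two_pos (le_trans ?_ this)
  linarith

theorem prod_zpow_neg (e : Fin d → ℤ) : ∏ i, (2 : ℝ) ^ (-e i) = 2 ^ (-∑ i, e i) := by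
  rw [← Finset.sum_neg_distrib]
  induction (Finset.univ : Finset (Fin d)) using Finset.cons_induction with
  | empty => simp
  | cons a s ha ih => rw [Finset.sum_cons, Finset.prod_cons, zpow_add₀ two_ne_zero, ih]

theorem subrectangle_mem_openRectangles {N : ℕ} (e : Fin d → ℤ) (x : Fin d → ℝ)
    (s : Fin d → Fin N) : subrectangle e x s ∈ SupNorm.openRectangles d := by
  refine ⟨_, _, fun i => ?_, rfl⟩
  have hN : (0 : ℝ) < N := by exact_mod_cast (s i).pos
  rw [← sub_pos, subinterval_length]
  positivity

theorem volume_subrectangle {N : ℕ} (e : Fin d → ℤ) (x : Fin d → ℝ) (s : Fin d → Fin N) :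
    volume (subrectangle e x s) = ENNReal.ofReal (∏ i, 2 ^ (-e i) / N) := by
  simp only [subrectangle, subinterval]
  rw [Real.volume_pi_Ioo, ENNReal.ofReal_prod_of_nonneg (fun i _ => by positivity)]
  exact Finset.prod_congr rfl fun i _ => by rw [subinterval_length]

/-- For `e = j` this is an equality, as `(2 R ^ 2) ^ d * 4 ^ d = N ^ d`; a coarser `e` only enlarges
the rectangles. This covers `j ⊓ j'`. -/
theorem bandwidth_le_volume {r : Fin d → ℕ} (hr : r ≠ 0) {e j : Fin d → ℤ} (he : e ≤ j) :
    4 * SupNorm.bandwidth r (SupNorm.piecewisePoly r (SupNorm.dyadicPartition j)) ≤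
      ∏ i, 2 ^ (-e i) / ((8 * (∑ i, r i) ^ 2 : ℕ) : ℝ) := by
  have hR : (0 : ℝ) < ((∑ i, r i : ℕ) : ℝ) := by exact_mod_cast sum_pos_of_ne_zero hr
  rw [SupNorm.bandwidth_piecewisePoly, Finset.prod_div_distrib, prod_zpow_neg, Finset.prod_const,
    Finset.card_univ, Fintype.card_fin]
  have e1 : ((8 * (∑ i, r i) ^ 2 : ℕ) : ℝ) ^ d = (2 * ((∑ i, r i : ℕ) : ℝ) ^ 2) ^ d * 4 ^ d := by
    rw [← mul_pow]
    push_cast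
    ring
  rw [e1, pow_succ (4 : ℝ), ← mul_assoc, ← div_div, mul_div_cancel₀ _ four_ne_zero]
  gcongr
  · norm_num
  · exact he _

/-- With `V` the volume of the subrectangle, `(V + h) / V ≤ 5/4`. -/
theorem abs_average_le {N : ℕ} {e : Fin d → ℤ} {x : Fin d → ℝ} {s : Fin d → Fin N} {h : ℝ}
    (hh0 : 0 ≤ h) (hh : 4 * h ≤ ∏ i, 2 ^ (-e i) / (N : ℝ)) {f : (Fin d → ℝ) → ℝ}
    (hf : SupNorm.hNorm volume (SupNorm.openRectangles d) h f ≠ ⊤) :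
    |(∏ i, (N / 2 ^ (-e i) : ℝ)) * ∫ y in subrectangle e x s, f y| ≤
      5 / 4 * (SupNorm.hNorm volume (SupNorm.openRectangles d) h f).toReal := by
  set H := SupNorm.hNorm volume (SupNorm.openRectangles d) h f with hH
  have hV : 0 < ∏ i, 2 ^ (-e i) / (N : ℝ) := Finset.prod_pos fun i _ => by
    have : (0 : ℝ) < N := by exact_mod_cast (s i).pos
    positivity
  have hinv : ∏ i, (N / 2 ^ (-e i) : ℝ) = (∏ i, 2 ^ (-e i) / (N : ℝ))⁻¹ := by
    rw [← Finset.prod_inv_distrib]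
    simp only [inv_div]
  have hle : ENNReal.ofReal |∫ y in subrectangle e x s, f y| /
      (volume (subrectangle e x s) + ENNReal.ofReal h) ≤ H :=
    le_iSup₂_of_le (f := fun C _ => ENNReal.ofReal |∫ y in C, f y| /
      (volume C + ENNReal.ofReal h)) _ (subrectangle_mem_openRectangles e x s) le_rfl
  rw [volume_subrectangle, ← ENNReal.ofReal_add hV.le hh0,
    ← ENNReal.ofReal_div_of_pos (by linarith), ← ENNReal.ofReal_toReal hf,
    ENNReal.ofReal_le_ofReal_iff ENNReal.toReal_nonneg, div_le_iff₀ (by linarith)] at hle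
  rw [abs_mul, hinv, abs_of_pos (inv_pos.2 hV), inv_mul_le_iff₀ hV]
  have : H.toReal * h ≤ H.toReal * ((∏ i, 2 ^ (-e i) / (N : ℝ)) / 4) :=
    mul_le_mul_of_nonneg_left (by linarith) ENNReal.toReal_nonneg
  linarith

/-! ### Comparison of the norms and conclusion -/

theorem abs_sub_apply_le {r : Fin d → ℕ} (hr : r ≠ 0) {j j' : Fin d → ℤ} {h : ℝ} (hh0 : 0 ≤ h)
    (hj : h ≤ SupNorm.bandwidth r (SupNorm.piecewisePoly r (SupNorm.dyadicPartition j)))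
    (hj' : h ≤ SupNorm.bandwidth r (SupNorm.piecewisePoly r (SupNorm.dyadicPartition j')))
    {p q : (Fin d → ℝ) → ℝ} (hp : p ∈ Submodule.span ℝ (cellMonomials r j))
    (hq : q ∈ Submodule.span ℝ (cellMonomials r j'))
    (hf : SupNorm.hNorm volume (SupNorm.openRectangles d) h (p - q) ≠ ⊤) (x : Fin d → ℝ) :
    |(p - q) x| ≤
      15 / 2 * (SupNorm.hNorm volume (SupNorm.openRectangles d) h (p - q)).toReal := by
  choose W hWc hW using fun (i : Fin d) (e : ℤ) => exists_weights_subinterval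
    (four_mul_sq_lt hr i) (by positivity : (0 : ℝ) < 2 ^ (-e)) (mem_Icc_dyadicLeft e (x i))
  have bound : ∀ e : Fin d → ℤ, (e ≤ j ∨ e ≤ j') →
      |tensorAverageComb (fun i => W i (e i)) e x (p - q)| ≤
        5 / 2 * (SupNorm.hNorm volume (SupNorm.openRectangles d) h (p - q)).toReal := by
    intro e he
    have hV : 4 * h ≤ ∏ i, 2 ^ (-e i) / ((8 * (∑ i, r i) ^ 2 : ℕ) : ℝ) := by
      rcases he with he | he
      · exact (mul_le_mul_of_nonneg_left hj (by norm_num)).trans (bandwidth_le_volume hr he)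
      · exact (mul_le_mul_of_nonneg_left hj' (by norm_num)).trans (bandwidth_le_volume hr he)
    have hc : ∏ i, ∑ s, |W i (e i) s| ≤ 2 :=
      (Finset.prod_le_prod (fun i _ => Finset.sum_nonneg fun s _ => abs_nonneg _)
        fun i _ => hWc i (e i)).trans (prod_inv_le_two hr)
    refine (abs_tensorAverageComb_le fun s => abs_average_le hh0 hV hf).trans ?_
    have := mul_le_mul_of_nonneg_right hc (ENNReal.toReal_nonneg
      (a := SupNorm.hNorm volume (SupNorm.openRectangles d) h (p - q)))
    linarith
  rw [sub_apply_eq_tensorAverageComb hW hp hq]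
  have h1 := abs_le.1 (bound j (Or.inl le_rfl))
  have h2 := abs_le.1 (bound j' (Or.inr le_rfl))
  have h3 := abs_le.1 (bound (j ⊓ j') (Or.inl inf_le_left))
  rw [abs_le]
  constructor <;> linarith [h1.1, h1.2, h2.1, h2.2, h3.1, h3.2]

theorem bandwidth_pos {r : Fin d → ℕ} (hr : r ≠ 0) (j : Fin d → ℤ) :
    0 < SupNorm.bandwidth r (SupNorm.piecewisePoly r (SupNorm.dyadicPartition j)) := by
  have hR : (0 : ℝ) < ((∑ i, r i : ℕ) : ℝ) := by exact_mod_cast sum_pos_of_ne_zero hr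
  rw [SupNorm.bandwidth_piecewisePoly]
  positivity

theorem le_hNorm_div_eLpNorm {r : Fin d → ℕ} (hr : r ≠ 0) {j j' : Fin d → ℤ} {h c : ℝ}
    (hh0 : 0 ≤ h)
    (hj : h ≤ SupNorm.bandwidth r (SupNorm.piecewisePoly r (SupNorm.dyadicPartition j)))
    (hj' : h ≤ SupNorm.bandwidth r (SupNorm.piecewisePoly r (SupNorm.dyadicPartition j')))
    (hc0 : 0 < c) (hc : 15 / 2 ≤ c⁻¹) {p q : (Fin d → ℝ) → ℝ}
    (hp : p ∈ SupNorm.piecewisePoly r (SupNorm.dyadicPartition j))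
    (hq : q ∈ SupNorm.piecewisePoly r (SupNorm.dyadicPartition j'))
    (hpq : eLpNorm (p - q) ⊤ volume ≠ 0) :
    ENNReal.ofReal c ≤ SupNorm.hNorm volume (SupNorm.openRectangles d) h (p - q) /
      eLpNorm (p - q) ⊤ volume := by
  have hp := piecewisePoly_subset_span r j hp
  have hq := piecewisePoly_subset_span r j' hq
  obtain ⟨M, hM⟩ := exists_abs_le_of_mem_span hp
  obtain ⟨M', hM'⟩ := exists_abs_le_of_mem_span hq
  -- An infinite denominator could make the quotient zero; `p` and `q` are bounded.
  have htop : eLpNorm (p - q) ⊤ volume ≠ ⊤ := by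
    rw [eLpNorm_exponent_top]
    refine ((eLpNormEssSup_le_of_ae_bound (C := M + M')
      (Filter.Eventually.of_forall fun x => ?_)).trans_lt
        ENNReal.ofReal_lt_top).ne
    exact (abs_sub _ _).trans (add_le_add (hM x) (hM' x))
  rw [ENNReal.le_div_iff_mul_le (Or.inl hpq) (Or.inl htop)]
  by_cases hf : SupNorm.hNorm volume (SupNorm.openRectangles d) h (p - q) = ⊤
  · rw [hf]; exact le_top
  have hle : eLpNorm (p - q) ⊤ volume ≤ ENNReal.ofReal (c⁻¹ *
      (SupNorm.hNorm volume (SupNorm.openRectangles d) h (p - q)).toReal) := by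
    rw [eLpNorm_exponent_top]
    refine eLpNormEssSup_le_of_ae_bound (Filter.Eventually.of_forall fun x => ?_)
    exact (abs_sub_apply_le hr hh0 hj hj' hp hq hf x).trans
      (mul_le_mul_of_nonneg_right hc ENNReal.toReal_nonneg)
  refine (mul_le_mul_right hle _).trans ?_
  rw [← ENNReal.ofReal_mul hc0.le, mul_inv_cancel_left₀ hc0.ne', ENNReal.ofReal_toReal hf]

theorem mainTheorem5 {d : ℕ} (r : Fin d → ℕ) (hr : r ≠ 0) :
    (∀ m ∈ SupNorm.dyadicModels r, ∀ m' ∈ SupNorm.dyadicModels r,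
      ENNReal.ofReal ((4 * (1 + 4 * Real.sqrt (∏ i, ((r i : ℝ) + 1))))⁻¹) ≤
        SupNorm.kappa volume (SupNorm.openRectangles d) (m ∪ m')
          (min (SupNorm.bandwidth r m) (SupNorm.bandwidth r m'))) ∧
    SupNorm.ModelSelectionAssumption volume (SupNorm.openRectangles d)
      (SupNorm.dyadicModels r) (SupNorm.bandwidth r) := by
  have hc0 : 0 < (4 * (1 + 4 * Real.sqrt (∏ i, ((r i : ℝ) + 1))))⁻¹ := by positivity
  -- The product is at least 1, so the right side is at least 20.
  have hc : 15 / 2 ≤ (4 * (1 + 4 * Real.sqrt (∏ i, ((r i : ℝ) + 1))))⁻¹⁻¹ := by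
    have : 1 ≤ Real.sqrt (∏ i, ((r i : ℝ) + 1)) := Real.one_le_sqrt.2 <|
      Finset.prod_induction _ (1 ≤ ·) (fun _ _ => one_le_mul_of_one_le_of_one_le) le_rfl
        fun i _ => by simp
    rw [inv_inv]
    linarith
  have key : ∀ m ∈ SupNorm.dyadicModels r, ∀ m' ∈ SupNorm.dyadicModels r,
      ENNReal.ofReal ((4 * (1 + 4 * Real.sqrt (∏ i, ((r i : ℝ) + 1))))⁻¹) ≤
        SupNorm.kappa volume (SupNorm.openRectangles d) (m ∪ m')
          (min (SupNorm.bandwidth r m) (SupNorm.bandwidth r m')) := by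
    rintro _ ⟨j, rfl⟩ _ ⟨j', rfl⟩
    have h0 := (lt_min (bandwidth_pos hr j) (bandwidth_pos hr j')).le
    refine le_iInf₂ fun p hp => le_iInf₂ fun q hq => le_iInf fun hpq => ?_
    -- When `p` and `q` lie in the same model, the comparison is used with equal scales.
    rcases hp with hp | hp <;> rcases hq with hq | hq <;>
      refine le_hNorm_div_eLpNorm hr h0 ?_ ?_ hc0 hc hp hq hpq <;>
      first | exact min_le_left _ _ | exact min_le_right _ _
  refine ⟨key, ?_, ?_⟩
  · rintro _ ⟨j, rfl⟩
    exact bandwidth_pos hr j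
  · exact (ENNReal.ofReal_pos.2 hc0).trans_le
      (le_iInf₂ fun m hm => le_iInf₂ fun m' hm' => key m hm m' hm')
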